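/- Let $\Omega\subset\mathbb{C}^d$ be a domain (a nonempty connected open set). Let $k_\Omega(z;v)=\inf\{|c| : f:\mathbb{D}\to\Omega \text{ holomorphic},\ f(0)=z,\ c\,f'(0)=v\}$ be the infinitesimal Kobayashi pseudo-metric, and let $K_\Omega$ be the Kobayashi pseudo-distance, i.e. the infimum, over finite chains of holomorphic discs $\mathbb{D}\to\Omega$ from $z$ to $w$, of the total length measured by the Poincaré distance $\tanh^{-1}\left|\frac{a-b}{1-\bar b a}\right|$ of $\mathbb{D}$. The domain $\Omega$ is Kobayashi hyperbolic if $K_\Omega$ is a distance. Let $(x|y)_o=\tfrac12\big(K_\Omega(o,x)+K_\Omega(o,y)-K_\Omega(x,y)\big)$ be the Gromov product. The space $(\Omega,K_\Omega)$ is Gromov hyperbolic if there is $\delta\ge 0$ with $\min\{(a|b)_o,(b|c)_o\}\le (a|c)_o+\delta$ for all $a,b,c,o\in\Omega$. In that case the Gromov boundary $\partial_G\Omega$ is the set of equivalence classes of sequences $(x_n)$ in $\Omega$ with $\lim_{m,n\to\infty}(x_m|x_n)_o=+\infty$, where $(x_n)\sim(y_n)$ means $\lim_{m,n\to\infty}(x_m|y_n)_o=+\infty$.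 For $\xi,\eta\in\partial_G\Omega$ and $x\in\Omega$, let $(x|\xi)_o=\inf\liminf_{n}(x|y_n)_o$ and $(\eta|\xi)_o=\inf\liminf_{m,n}(u_m|y_n)_o$, the infima being over all $(u_m)\in\eta$, $(y_n)\in\xi$. A set $S\subset\Omega\cup\partial_G\Omega$ is open if $S\cap\Omega$ is open in $(\Omega,K_\Omega)$ and, for each $\xi\in S\cap\partial_G\Omega$, $S$ contains $\{y\in\Omega\cup\partial_G\Omega : (y|\xi)_o>t\}$ for some $t$. An end $e$ of $\overline\Omega$ (the Euclidean closure) assigns to each compact $C\subset\overline\Omega$ a connected component $e(C)$ of $\overline\Omega\setminus C$ such that $e(C')\subset e(C)$ whenever $C\subset C'$. The end compactification $\overline\Omega^{End}$ is $\overline\Omega$ together with its ends; a set $W$ is open if $W\cap\overline\Omega$ is open in $\overline\Omega$ and, for each end $e\in W$, $W$ contains $e(C)\cup\{\text{ends } f : f(C)=e(C)\}$ for some compact $C$. Write $\partial\overline\Omega^{End}=\overline\Omega^{End}\setminus\Omega$. For $\kappa\ge0$, a $(1,\kappa)$-almost-geodesic is an absolutely continuous map $\sigma:[0,T]\to\Omega$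 such that $|t-s|-\kappa\le K_\Omega(\sigma(t),\sigma(s))\le|t-s|+\kappa$ for all $s,t\in[0,T]$ and $k_\Omega(\sigma(t);\sigma'(t))\le1$ for almost every $t\in[0,T]$. The domain $\Omega$ is a weak visibility domain if it is Kobayashi hyperbolic and, for every $\kappa\ge0$, all distinct $\xi,\eta\in\partial\overline\Omega^{End}$ and all $\overline\Omega^{End}$-open neighborhoods $V_\xi,V_\eta$ of $\xi,\eta$ with disjoint closures in $\overline\Omega^{End}$, there is a compact set $K\subset\Omega$ such that $\sigma([0,T])\cap K\ne\emptyset$ for every $(1,\kappa)$-almost-geodesic $\sigma:[0,T]\to\Omega$ with $\sigma(0)\in V_\xi$ and $\sigma(T)\in V_\eta$. **Theorem.** Suppose that $\Omega$ is Kobayashi hyperbolic and that $(\Omega,K_\Omega)$ is Gromov hyperbolic. If the identity map of $\Omega$ extends to a homeomorphism from $\Omega\cup\partial_G\Omega$ onto $\overline\Omega^{End}$, then: (1) $(\Omega,K_\Omega)$ is Cauchy-complete; (2) $\Omega$ is a weak visibility domain. -/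

import Mathlib

open Set Filter Topology MeasureTheory

noncomputable section

/-! ### Gromov hyperbolic spaces and the Gromov bordification -/

section Gromov

variable {X : Type*} [PseudoMetricSpace X]

/-- The Gromov product `(x|y)_o`. -/
def gromovProduct (o x y : X) : ℝ :=
  (dist o x + dist o y - dist x y) / 2

/-- Gromov hyperbolicity, through the four-point condition. -/
def IsGromovHyperbolic (X : Type*) [PseudoMetricSpace X] : Prop :=
  ∃ δ : ℝ, 0 ≤ δ ∧ ∀ a b c o : X,
    min (gromovProduct o a b) (gromovProduct o b c) ≤ gromovProduct o a c + δ

/-- `(x_m|y_n)_o → +∞` as `m, n → ∞`, for every base point `o`. -/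
def GromovEquivalent (x y : ℕ → X) : Prop :=
  ∀ o : X, Tendsto (fun p : ℕ × ℕ => gromovProduct o (x p.1) (y p.2)) atTop atTop

/-- Gromov sequences. -/
def IsGromovSequence (x : ℕ → X) : Prop := GromovEquivalent x x

theorem gromovProduct_comm (o x y : X) : gromovProduct o x y = gromovProduct o y x := by
  unfold gromovProduct
  rw [dist_comm x y]
  ring

theorem GromovEquivalent.symm {x y : ℕ → X} (h : GromovEquivalent x y) :
    GromovEquivalent y x := by
  intro o
  rw [tendsto_atTop_atTop]
  intro b
  obtain ⟨⟨i, j⟩, hij⟩ := (tendsto_atTop_atTop.1 (h o)) b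
  refine ⟨(j, i), fun p hp => ?_⟩
  have := hij (p.2, p.1) ⟨hp.2, hp.1⟩
  rwa [gromovProduct_comm]

theorem GromovEquivalent.trans (hX : IsGromovHyperbolic X) {x y z : ℕ → X}
    (h₁ : GromovEquivalent x y) (h₂ : GromovEquivalent y z) : GromovEquivalent x z := by
  obtain ⟨δ, -, hδ⟩ := hX
  intro o
  rw [tendsto_atTop_atTop]
  intro b
  obtain ⟨⟨i, j⟩, hij⟩ := (tendsto_atTop_atTop.1 (h₁ o)) (b + δ)
  obtain ⟨⟨k, l⟩, hkl⟩ := (tendsto_atTop_atTop.1 (h₂ o)) (b + δ)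
  refine ⟨(i, l), fun p hp => ?_⟩
  have e₁ := hij (p.1, max j k) ⟨hp.1, le_max_left _ _⟩
  have e₂ := hkl (max j k, p.2) ⟨le_max_right _ _, hp.2⟩
  have e₃ := hδ (x p.1) (y (max j k)) (z p.2) o
  have e₄ := le_min e₁ e₂
  simp only at e₄
  linarith

/-- The equivalence relation on Gromov sequences. -/
def gromovSetoid (hX : IsGromovHyperbolic X) : Setoid {x : ℕ → X // IsGromovSequence x} where
  r x y := GromovEquivalent x.1 y.1
  iseqv := ⟨fun x => x.2, fun h => h.symm, fun h₁ h₂ => h₁.trans hX h₂⟩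

/-- The Gromov boundary: equivalence classes of Gromov sequences. -/
def GromovBoundary (hX : IsGromovHyperbolic X) : Type _ := Quotient (gromovSetoid hX)

/-- The sequence `x` is a Gromov sequence whose class is `ξ`. -/
def Represents {hX : IsGromovHyperbolic X} (x : ℕ → X) (ξ : GromovBoundary hX) : Prop :=
  ∃ h : IsGromovSequence x, Quotient.mk (gromovSetoid hX) ⟨x, h⟩ = ξ

/-- The union of a Gromov hyperbolic space and its Gromov boundary. -/
inductive GromovBordification (hX : IsGromovHyperbolic X) : Type _
  | point (x : X) : GromovBordification hX
  | bdry (ξ : GromovBoundary hX) : GromovBordification hX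

/-- The Gromov product `(y|ξ)_o` extended to `y ∈ X ∪ ∂X` and `ξ ∈ ∂X`: the infimum of the lower
limits over all sequences representing the boundary points involved. -/
def extGromovProduct {hX : IsGromovHyperbolic X} (o : X) (ξ : GromovBoundary hX) :
    GromovBordification hX → EReal
  | .point x => sInf {r : EReal | ∃ s : ℕ → X, Represents s ξ ∧
      r = liminf (fun n => ((gromovProduct o x (s n) : ℝ) : EReal)) atTop}
  | .bdry η => sInf {r : EReal | ∃ u s : ℕ → X, Represents u η ∧ Represents s ξ ∧
      r = liminf (fun p : ℕ × ℕ => ((gromovProduct o (u p.1) (s p.2) : ℝ) : EReal)) atTop}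

/-- A set `S ⊆ X ∪ ∂X` is open iff `S ∩ X` is open in `X` and, for each `ξ ∈ S ∩ ∂X` (and each
base point `o`), `S` contains `{y : (y|ξ)_o > t}` for some `t`. -/
instance (hX : IsGromovHyperbolic X) : TopologicalSpace (GromovBordification hX) where
  IsOpen S := IsOpen {x : X | GromovBordification.point x ∈ S} ∧
    ∀ ξ : GromovBoundary hX, GromovBordification.bdry ξ ∈ S → ∀ o : X, ∃ t : ℝ,
      ∀ y : GromovBordification hX, (t : EReal) < extGromovProduct o ξ y → y ∈ S
  isOpen_univ := ⟨by simp, fun _ _ _ => ⟨0, fun _ _ => mem_univ _⟩⟩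
  isOpen_inter := by
    rintro S T ⟨hS, hS'⟩ ⟨hT, hT'⟩
    refine ⟨hS.inter hT, fun ξ hξ o => ?_⟩
    obtain ⟨t, ht⟩ := hS' ξ hξ.1 o
    obtain ⟨u, hu⟩ := hT' ξ hξ.2 o
    refine ⟨max t u, fun y hy => ⟨ht y (lt_of_le_of_lt ?_ hy), hu y (lt_of_le_of_lt ?_ hy)⟩⟩
    · exact_mod_cast le_max_left t u
    · exact_mod_cast le_max_right t u
  isOpen_sUnion := by
    intro 𝒮 h
    constructor
    · have : {x : X | GromovBordification.point x ∈ ⋃₀ 𝒮} =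
          ⋃ S ∈ 𝒮, {x : X | (GromovBordification.point x : GromovBordification hX) ∈ S} := by
        ext x
        simp
      rw [this]
      exact isOpen_biUnion fun S hS => (h S hS).1
    · rintro ξ ⟨S, hS, hξ⟩ o
      obtain ⟨t, ht⟩ := (h S hS).2 ξ hξ o
      exact ⟨t, fun y hy => ⟨S, hS, ht y hy⟩⟩

end Gromov

/-! ### The end compactification -/

section Ends

/-- An end of `Y`: a choice, compatible with inclusions, of a connected component of the complement
of each compact subset of `Y`. -/
structure SpaceEnd (Y : Type*) [TopologicalSpace Y] where
  comp : TopologicalSpace.Compacts Y → Set Y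
  isComponent : ∀ K : TopologicalSpace.Compacts Y, ∃ y ∈ (K : Set Y)ᶜ, comp K = connectedComponentIn (K : Set Y)ᶜ y
  anti : ∀ K L : TopologicalSpace.Compacts Y, K ≤ L → comp L ⊆ comp K

/-- The union of `Y` and the set of its ends. -/
inductive EndCompactification (Y : Type*) [TopologicalSpace Y] : Type _
  | point (y : Y) : EndCompactification Y
  | atEnd (e : SpaceEnd Y) : EndCompactification Y

variable {Y : Type*} [TopologicalSpace Y]

/-- The basic neighborhood of the end `e` determined by the compact set `K`: the component chosen
by `e`, together with all ends that choose the same component. -/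
def endNeighborhood (e : SpaceEnd Y) (K : TopologicalSpace.Compacts Y) :
    Set (EndCompactification Y) :=
  {p | (∃ y ∈ e.comp K, p = .point y) ∨ ∃ f : SpaceEnd Y, f.comp K = e.comp K ∧ p = .atEnd f}

theorem endNeighborhood_anti (e : SpaceEnd Y) {K L : TopologicalSpace.Compacts Y} (h : K ≤ L) :
    endNeighborhood e L ⊆ endNeighborhood e K := by
  rintro p (⟨y, hy, rfl⟩ | ⟨f, hf, rfl⟩)
  · exact Or.inl ⟨y, e.anti K L h hy, rfl⟩
  · refine Or.inr ⟨f, ?_, rfl⟩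
    obtain ⟨x, hx, hfx⟩ := f.isComponent K
    obtain ⟨y, hy, hey⟩ := e.isComponent K
    obtain ⟨z, hz, hez⟩ := e.isComponent L
    have hzL : z ∈ e.comp L := hez ▸ mem_connectedComponentIn hz
    have h₁ : z ∈ connectedComponentIn (K : Set Y)ᶜ y := hey ▸ e.anti K L h hzL
    have h₂ : z ∈ connectedComponentIn (K : Set Y)ᶜ x := hfx ▸ f.anti K L h (hf ▸ hzL)
    rw [hfx, hey, connectedComponentIn_eq h₁, connectedComponentIn_eq h₂]

/-- A set is open iff its trace on `Y` is open and it contains a basic neighborhood of each of its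
ends. -/
instance : TopologicalSpace (EndCompactification Y) where
  IsOpen W := IsOpen {y : Y | EndCompactification.point y ∈ W} ∧
    ∀ e : SpaceEnd Y, EndCompactification.atEnd e ∈ W →
      ∃ K : TopologicalSpace.Compacts Y, endNeighborhood e K ⊆ W
  isOpen_univ := ⟨by simp, fun _ _ => ⟨⊥, subset_univ _⟩⟩
  isOpen_inter := by
    rintro S T ⟨hS, hS'⟩ ⟨hT, hT'⟩
    refine ⟨hS.inter hT, fun e he => ?_⟩
    obtain ⟨K, hK⟩ := hS' e he.1
    obtain ⟨L, hL⟩ := hT' e he.2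
    exact ⟨K ⊔ L, subset_inter ((endNeighborhood_anti e le_sup_left).trans hK)
      ((endNeighborhood_anti e le_sup_right).trans hL)⟩
  isOpen_sUnion := by
    intro 𝒮 h
    constructor
    · have : {y : Y | EndCompactification.point y ∈ ⋃₀ 𝒮} =
          ⋃ S ∈ 𝒮, {y : Y | EndCompactification.point y ∈ S} := by
        ext y
        simp
      rw [this]
      exact isOpen_biUnion fun S hS => (h S hS).1
    · rintro e ⟨S, hS, he⟩
      obtain ⟨K, hK⟩ := (h S hS).2 e he
      exact ⟨K, hK.trans (subset_sUnion_of_mem hS)⟩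

end Ends

/-! ### The Kobayashi distance and the Kobayashi metric -/

section Kobayashi

variable {d : ℕ}

/-- A domain in `ℂ^d`: a nonempty connected open set. -/
structure ComplexDomain (d : ℕ) where
  carrier : Set (EuclideanSpace ℂ (Fin d))
  isOpen : IsOpen carrier
  isConnected : IsConnected carrier

/-- `f` restricts to a holomorphic map from the open unit disc to `Ω`. -/
def IsHolomorphicDisc (Ω : Set (EuclideanSpace ℂ (Fin d))) (f : ℂ → EuclideanSpace ℂ (Fin d)) :
    Prop :=
  DifferentiableOn ℂ f (Metric.ball 0 1) ∧ MapsTo f (Metric.ball 0 1) Ω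

/-- The Poincaré distance on the unit disc, i.e. the distance of the metric `|dz| / (1 - |z|²)`. -/
def poincareDist (a b : ℂ) : ℝ :=
  Real.artanh ‖(a - b) / (1 - (starRingEnd ℂ) b * a)‖

/-- `KobayashiChain Ω z w L`: there is a finite chain of holomorphic discs in `Ω` from `z` to `w`
of total Poincaré length `L`. -/
inductive KobayashiChain (Ω : Set (EuclideanSpace ℂ (Fin d))) :
    EuclideanSpace ℂ (Fin d) → EuclideanSpace ℂ (Fin d) → ℝ → Prop
  | refl (z : EuclideanSpace ℂ (Fin d)) (hz : z ∈ Ω) : KobayashiChain Ω z z 0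
  | step {z : EuclideanSpace ℂ (Fin d)} {L : ℝ} (f : ℂ → EuclideanSpace ℂ (Fin d))
      (hf : IsHolomorphicDisc Ω f) (a b : ℂ) (ha : a ∈ Metric.ball (0 : ℂ) 1)
      (hb : b ∈ Metric.ball (0 : ℂ) 1) (h : KobayashiChain Ω z (f a) L) :
      KobayashiChain Ω z (f b) (L + poincareDist a b)

/-- The Kobayashi pseudo-distance `K_Ω`. -/
def kobayashiDist (Ω : Set (EuclideanSpace ℂ (Fin d))) (z w : EuclideanSpace ℂ (Fin d)) : ℝ :=
  sInf {L : ℝ | KobayashiChain Ω z w L}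

/-- The infinitesimal Kobayashi pseudo-metric `k_Ω(z; v)`. -/
def kobayashiMetric (Ω : Set (EuclideanSpace ℂ (Fin d))) (z v : EuclideanSpace ℂ (Fin d)) : ℝ :=
  sInf {r : ℝ | ∃ f : ℂ → EuclideanSpace ℂ (Fin d), IsHolomorphicDisc Ω f ∧ f 0 = z ∧
    ∃ c : ℂ, c • deriv f 0 = v ∧ r = ‖c‖}

theorem poincareDist_nonneg (a b : ℂ) : 0 ≤ poincareDist a b :=
  Real.artanh_nonneg (norm_nonneg _)

theorem poincareDist_comm (a b : ℂ) : poincareDist a b = poincareDist b a := by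
  unfold poincareDist
  rw [norm_div, norm_div, norm_sub_rev a b]
  have : 1 - (starRingEnd ℂ) a * b = (starRingEnd ℂ) (1 - (starRingEnd ℂ) b * a) := by
    simp [mul_comm]
  rw [this, Complex.norm_conj]

variable {Ω : Set (EuclideanSpace ℂ (Fin d))} {x y z : EuclideanSpace ℂ (Fin d)}

theorem KobayashiChain.nonneg {L : ℝ} (h : KobayashiChain Ω x y L) : 0 ≤ L := by
  induction h with
  | refl => exact le_rfl
  | step f hf a b ha hb h ih => exact add_nonneg ih (poincareDist_nonneg a b)

theorem KobayashiChain.trans {L M : ℝ} (h₁ : KobayashiChain Ω x y L)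
    (h₂ : KobayashiChain Ω y z M) : KobayashiChain Ω x z (L + M) := by
  induction h₂ with
  | refl => simpa using h₁
  | step f hf a b ha hb h ih => simpa [add_assoc] using KobayashiChain.step f hf a b ha hb ih

theorem KobayashiChain.symm {L : ℝ} (h : KobayashiChain Ω x y L) : KobayashiChain Ω y x L := by
  induction h with
  | refl hz => exact .refl _ hz
  | step f hf a b ha hb h ih =>
    have e := KobayashiChain.step f hf b a hb ha (.refl (f b) (hf.2 hb))
    have e' := e.trans ih
    rwa [zero_add, poincareDist_comm, add_comm] at e'

theorem exists_kobayashiChain (Ω : ComplexDomain d) {x y : EuclideanSpace ℂ (Fin d)}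
    (hx : x ∈ Ω.carrier) (hy : y ∈ Ω.carrier) : ∃ L, KobayashiChain Ω.carrier x y L := by
  refine Ω.isConnected.isPreconnected.induction₂
    (fun x y => ∃ L, KobayashiChain Ω.carrier x y L) ?_ ?_ ?_ hx hy
  · intro x hx
    obtain ⟨r, hr, hball⟩ := Metric.isOpen_iff.1 Ω.isOpen x hx
    have hmem : Metric.ball x (r / 2) ∈ 𝓝[Ω.carrier] x :=
      mem_nhdsWithin_of_mem_nhds (Metric.ball_mem_nhds x (by positivity))
    filter_upwards [hmem] with y hy
    let f : ℂ → EuclideanSpace ℂ (Fin d) := fun c => x + c • ((2 : ℂ) • (y - x))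
    have hf : IsHolomorphicDisc Ω.carrier f := by
      refine ⟨by fun_prop, fun c hc => hball ?_⟩
      rw [mem_ball_zero_iff] at hc
      rw [Metric.mem_ball, dist_eq_norm] at hy
      rw [Metric.mem_ball, dist_eq_norm]
      simp only [f, add_sub_cancel_left, norm_smul, Complex.norm_ofNat]
      nlinarith [norm_nonneg c, norm_nonneg (y - x)]
    have h0 : f 0 = x := by simp [f]
    have h1 : f (1 / 2) = y := by simp [f, smul_smul]
    have e := KobayashiChain.step f hf 0 (1 / 2) (by simp) (by simp; norm_num)
      (.refl (f 0) (by rw [h0]; exact hx))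
    rw [h0, h1] at e
    exact ⟨_, e⟩
  · rintro x y z hx hy hz ⟨L, hL⟩ ⟨M, hM⟩
    exact ⟨_, hL.trans hM⟩
  · rintro x y hx hy ⟨L, hL⟩
    exact ⟨L, hL.symm⟩

/-- The set `Ω`, to be equipped with the Kobayashi pseudo-distance. -/
def KobayashiSpace (Ω : ComplexDomain d) : Type := {z : EuclideanSpace ℂ (Fin d) // z ∈ Ω.carrier}

/-- The (pseudo-)metric space `(Ω, K_Ω)`; its topology and uniformity are those of `K_Ω`. -/
instance (Ω : ComplexDomain d) : PseudoMetricSpace (KobayashiSpace Ω) where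
  dist z w := kobayashiDist Ω.carrier z.1 w.1
  dist_self z := le_antisymm
    (csInf_le ⟨0, fun _ h => KobayashiChain.nonneg h⟩ (KobayashiChain.refl z.1 z.2))
    (Real.sInf_nonneg fun _ h => KobayashiChain.nonneg h)
  dist_comm z w := by
    have : {L : ℝ | KobayashiChain Ω.carrier z.1 w.1 L} =
        {L : ℝ | KobayashiChain Ω.carrier w.1 z.1 L} := by
      ext L
      exact ⟨fun h => h.symm, fun h => h.symm⟩
    unfold kobayashiDist
    rw [this]
  dist_triangle x y z := by
    refine le_of_forall_pos_lt_add fun ε hε => ?_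
    obtain ⟨L, hL, hL'⟩ := Real.lt_sInf_add_pos
      (s := {L : ℝ | KobayashiChain Ω.carrier x.1 y.1 L})
      (exists_kobayashiChain Ω x.2 y.2) (half_pos hε)
    obtain ⟨M, hM, hM'⟩ := Real.lt_sInf_add_pos
      (s := {L : ℝ | KobayashiChain Ω.carrier y.1 z.1 L})
      (exists_kobayashiChain Ω y.2 z.2) (half_pos hε)
    have h : kobayashiDist Ω.carrier x.1 z.1 ≤ L + M :=
      csInf_le ⟨0, fun _ h => KobayashiChain.nonneg h⟩ (KobayashiChain.trans hL hM)
    unfold kobayashiDist at h ⊢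
    linarith

/-- `Ω` is Kobayashi hyperbolic if `K_Ω` is a distance. -/
def IsKobayashiHyperbolic (Ω : ComplexDomain d) : Prop :=
  ∀ z ∈ Ω.carrier, ∀ w ∈ Ω.carrier, kobayashiDist Ω.carrier z w = 0 → z = w

/-! ### Almost-geodesics and weak visibility -/

/-- The restriction of `σ` to `[0, T]` is a `(lam, κ)`-almost-geodesic in `Ω`. -/
structure IsAlmostGeodesic (Ω : ComplexDomain d) (lam κ T : ℝ)
    (σ : ℝ → EuclideanSpace ℂ (Fin d)) : Prop where
  nonneg : 0 ≤ T
  mapsTo : MapsTo σ (Icc 0 T) Ω.carrier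
  lower : ∀ s ∈ Icc 0 T, ∀ t ∈ Icc 0 T,
    lam⁻¹ * |t - s| - κ ≤ kobayashiDist Ω.carrier (σ t) (σ s)
  upper : ∀ s ∈ Icc 0 T, ∀ t ∈ Icc 0 T,
    kobayashiDist Ω.carrier (σ t) (σ s) ≤ lam * |t - s| + κ
  absolutelyContinuous : AbsolutelyContinuousOnInterval σ 0 T
  speed : ∀ᵐ t ∂(volume.restrict (Icc 0 T)),
    DifferentiableAt ℝ σ t ∧ kobayashiMetric Ω.carrier (σ t) (deriv σ t) ≤ lam

/-- The end compactification of the closure of `Ω`. -/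
abbrev ComplexDomain.EndClosure (Ω : ComplexDomain d) : Type :=
  EndCompactification (closure Ω.carrier)

/-- The inclusion of `Ω` in the end compactification of its closure. -/
def ComplexDomain.toEnd (Ω : ComplexDomain d) (z : EuclideanSpace ℂ (Fin d))
    (hz : z ∈ Ω.carrier) : Ω.EndClosure :=
  .point ⟨z, subset_closure hz⟩

/-- The boundary of `Ω` in the end compactification of its closure. -/
def ComplexDomain.endBoundary (Ω : ComplexDomain d) : Set Ω.EndClosure :=
  {p | ∀ z (hz : z ∈ Ω.carrier), p ≠ Ω.toEnd z hz}

/-- The visibility condition for `(lam, κ)`-almost-geodesics, for a fixed `lam` and all `κ ≥ 0`. -/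
def VisibilityCondition (Ω : ComplexDomain d) (lam : ℝ) : Prop :=
  ∀ κ : ℝ, 0 ≤ κ → ∀ ξ ∈ Ω.endBoundary, ∀ η ∈ Ω.endBoundary, ξ ≠ η →
    ∀ V W : Set Ω.EndClosure, IsOpen V → IsOpen W → ξ ∈ V → η ∈ W →
      Disjoint (closure V) (closure W) →
      ∃ K : Set (EuclideanSpace ℂ (Fin d)), IsCompact K ∧ K ⊆ Ω.carrier ∧
        ∀ (T : ℝ) (σ : ℝ → EuclideanSpace ℂ (Fin d)) (hσ : IsAlmostGeodesic Ω lam κ T σ),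
          Ω.toEnd (σ 0) (hσ.mapsTo (left_mem_Icc.2 hσ.nonneg)) ∈ V →
          Ω.toEnd (σ T) (hσ.mapsTo (right_mem_Icc.2 hσ.nonneg)) ∈ W →
          (σ '' Icc 0 T ∩ K).Nonempty

/-- Weak visibility domains (with respect to the Kobayashi distance). -/
def IsWeakVisibilityDomain (Ω : ComplexDomain d) : Prop :=
  IsKobayashiHyperbolic Ω ∧ VisibilityCondition Ω 1

/-- The identity map of `Ω` extends to a homeomorphism from `Ω ∪ ∂_G Ω` onto the end
compactification of the closure of `Ω`. -/
def IdExtendsToHomeomorph (Ω : ComplexDomain d)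
    (hG : IsGromovHyperbolic (KobayashiSpace Ω)) : Prop :=
  ∃ Φ : GromovBordification hG ≃ₜ Ω.EndClosure,
    ∀ z : KobayashiSpace Ω, Φ (.point z) = Ω.toEnd z.1 z.2

end Kobayashi

end

/-! The homeomorphism is used through one principle (`IdExtendsToHomeomorph.exists_tendsto`): a
Kobayashi-bounded family cannot converge to a Gromov boundary point, so if it converges in the end
compactification, its limit lies in `Ω`. In particular no compactness of the end compactification is
needed.

Completeness: let a Cauchy sequence have no limit. By the principle, small Kobayashi balls around
its tails leave every compact subset of the closure. These balls are connected, being swept out by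
chains of discs, so the tails select a component of each complement, that is, an end. The bounded
sequence converges to this end, against the principle.

Visibility: chains can be cut at any length, so `K_Ω` is an approximate length distance, and
completeness gives properness by a Hopf–Rinow argument. If visibility failed, almost-geodesics would
avoid larger and larger balls about `o`. In a Gromov hyperbolic space such a curve passes within
`(x|y)_o + 2δ + 3κ` of `o`, where `x`, `y` are its endpoints, so these products tend to infinity.
Along an ultrafilter both families of endpoints then converge to one Gromov boundary point, whose
image lies in the two disjoint closures. -/

/-! ### Approximate length spaces -/

section Length

variable {X : Type*} [PseudoMetricSpace X]

/-- Any two points have approximate intermediate points at every ratio. -/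
def HasApproxIntermediatePoints (X : Type*) [PseudoMetricSpace X] : Prop :=
  ∀ x y : X, ∀ s : ℝ, 0 ≤ s → s ≤ dist x y → ∀ ε : ℝ, 0 < ε →
    ∃ p : X, dist x p ≤ s ∧ dist p y ≤ dist x y - s + ε

theorem HasApproxIntermediatePoints.exists_mem_closedBall (h : HasApproxIntermediatePoints X)
    {o y : X} {r t : ℝ} (hr : 0 ≤ r) (hrt : r < t) {η : ℝ} (hη : t - r < η)
    (hy : y ∈ Metric.closedBall o t) : ∃ p ∈ Metric.closedBall o r, dist y p < η := by
  rw [Metric.mem_closedBall, dist_comm] at hy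
  rcases le_total (dist o y) r with hle | hle
  · exact ⟨y, by rwa [Metric.mem_closedBall, dist_comm], by rw [dist_self]; linarith⟩
  · obtain ⟨p, hp, hp'⟩ := h o y r hr hle ((η - (t - r)) / 2) (by linarith)
    refine ⟨p, by rwa [Metric.mem_closedBall, dist_comm], ?_⟩
    rw [dist_comm]
    linarith

/-- A version of the Hopf–Rinow theorem: complete locally compact approximate length spaces are
proper. -/
theorem HasApproxIntermediatePoints.properSpace [CompleteSpace X] [LocallyCompactSpace X]
    (h : HasApproxIntermediatePoints X) : ProperSpace X := by
  refine ⟨fun o => ?_⟩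
  have anti : ∀ {r t : ℝ}, r ≤ t → IsCompact (Metric.closedBall o t) →
      IsCompact (Metric.closedBall o r) := fun hrt ht =>
    ht.of_isClosed_subset Metric.isClosed_closedBall (Metric.closedBall_subset_closedBall hrt)
  -- compactness of all smaller balls passes to the limit radius
  have lim : ∀ t : ℝ, 0 < t → (∀ r, 0 ≤ r → r < t → IsCompact (Metric.closedBall o r)) →
      IsCompact (Metric.closedBall o t) := by
    intro t ht hr
    refine isCompact_iff_totallyBounded_isComplete.2 ⟨?_, Metric.isClosed_closedBall.isComplete⟩
    rw [Metric.totallyBounded_iff]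
    intro ε hε
    -- Every point of the large ball is within `ε / 2` of the ball of this radius, so an `ε / 2`-net
    -- of the latter is an `ε`-net of the former.
    have hlt : max 0 (t - ε / 4) < t := max_lt ht (by linarith)
    obtain ⟨s, hs, hcov⟩ := Metric.totallyBounded_iff.1
      (hr _ (le_max_left _ _) hlt).totallyBounded (ε / 2) (half_pos hε)
    refine ⟨s, hs, fun y hy => ?_⟩
    obtain ⟨p, hp, hyp⟩ := h.exists_mem_closedBall (le_max_left 0 (t - ε / 4)) hlt
      (η := ε / 2) (by linarith [le_max_right 0 (t - ε / 4)]) hy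
    obtain ⟨q, hq, hpq⟩ := mem_iUnion₂.1 (hcov hp)
    refine mem_iUnion₂.2 ⟨q, hq, ?_⟩
    rw [Metric.mem_ball] at hpq ⊢
    linarith [dist_triangle y p q]
  have ext : ∀ r : ℝ, 0 ≤ r → IsCompact (Metric.closedBall o r) →
      ∃ t, r < t ∧ IsCompact (Metric.closedBall o t) := by
    intro r hr hc
    -- Local compactness gives a compact `η`-thickening, which contains the ball of radius `r + η /
    -- 2`.
    obtain ⟨η, hη, hc'⟩ := hc.exists_isCompact_cthickening
    refine ⟨r + η / 2, by linarith, hc'.of_isClosed_subset Metric.isClosed_closedBall ?_⟩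
    intro y hy
    obtain ⟨p, hp, hyp⟩ := h.exists_mem_closedBall hr (by linarith : r < r + η / 2)
      (η := η) (by linarith) hy
    exact Metric.mem_cthickening_of_dist_le y p η _ hp hyp.le
  have zero : IsCompact (Metric.closedBall o 0) := by
    obtain ⟨K, hK, hKo⟩ := exists_compact_mem_nhds o
    obtain ⟨ε, hε, hsub⟩ := Metric.nhds_basis_closedBall.mem_iff.1 hKo
    exact hK.of_isClosed_subset Metric.isClosed_closedBall
      ((Metric.closedBall_subset_closedBall hε.le).trans hsub)
  by_contra hne
  push Not at hne
  obtain ⟨R, hR⟩ := hne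
  have hR0 : 0 < R := by
    by_contra hle
    exact hR (anti (not_lt.1 hle) zero)
  -- The supremum of the compact radii is attained by `lim` and exceeded by `ext`.
  let S : Set ℝ := {r | 0 ≤ r ∧ IsCompact (Metric.closedBall o r)}
  have hbdd : ∀ r ∈ S, r ≤ R := fun r hr => by
    by_contra hlt
    exact hR (anti (not_le.1 hlt).le hr.2)
  have hS : S.Nonempty := ⟨0, le_rfl, zero⟩
  have hsup0 : 0 ≤ sSup S := le_csSup ⟨R, hbdd⟩ ⟨le_rfl, zero⟩
  have hsup : IsCompact (Metric.closedBall o (sSup S)) := by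
    rcases hsup0.eq_or_lt with h0 | h0
    · rwa [← h0]
    · refine lim _ h0 fun r hr hlt => ?_
      obtain ⟨t, ht, hrt⟩ := exists_lt_of_lt_csSup hS hlt
      exact anti hrt.le ht.2
  obtain ⟨t, ht, htc⟩ := ext _ hsup0 hsup
  exact absurd (le_csSup ⟨R, hbdd⟩ ⟨hsup0.trans ht.le, htc⟩) (not_le.2 ht)

end Length

/-! ### Convergence to the Gromov boundary -/

section GromovConvergence

variable {X : Type*} [PseudoMetricSpace X]

theorem gromovProduct_le_dist (o x y : X) : gromovProduct o x y ≤ dist o x := by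
  unfold gromovProduct
  linarith [dist_triangle o x y]

theorem gromovProduct_le_add_dist (o o' x y : X) :
    gromovProduct o x y ≤ gromovProduct o' x y + dist o o' := by
  unfold gromovProduct
  linarith [dist_triangle o o' x, dist_triangle o o' y]

theorem gromovEquivalent_of_basePoint {x y : ℕ → X} (o : X)
    (h : Tendsto (fun p : ℕ × ℕ => gromovProduct o (x p.1) (y p.2)) atTop atTop) :
    GromovEquivalent x y := by
  intro o'
  refine tendsto_atTop_mono (f := fun p : ℕ × ℕ =>
    gromovProduct o (x p.1) (y p.2) + -dist o o') (fun p => ?_)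
    (tendsto_atTop_add_const_right _ _ h)
  linarith [gromovProduct_le_add_dist o o' (x p.1) (y p.2)]

theorem exists_represents {hX : IsGromovHyperbolic X} (ξ : GromovBoundary hX) :
    ∃ s : ℕ → X, Represents s ξ := by
  obtain ⟨s, hs⟩ := Quotient.exists_rep ξ
  exact ⟨s.1, s.2, hs⟩

theorem extGromovProduct_point_le {hX : IsGromovHyperbolic X} (o : X) (ξ : GromovBoundary hX)
    (z : X) : extGromovProduct o ξ (.point z) ≤ (dist o z : ℝ) := by
  obtain ⟨s, hs⟩ := exists_represents ξ
  have h : extGromovProduct o ξ (.point z) ≤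
      liminf (fun n => ((gromovProduct o z (s n) : ℝ) : EReal)) atTop := sInf_le ⟨s, hs, rfl⟩
  refine h.trans ((liminf_le_liminf (v := fun _ => ((dist o z : ℝ) : EReal))
    (Eventually.of_forall fun n => ?_)).trans (liminf_const _).le)
  exact_mod_cast gromovProduct_le_dist o z (s n)

/-- Points in a bounded set do not converge to the Gromov boundary. -/
theorem not_tendsto_bdry_of_dist_le {hX : IsGromovHyperbolic X} {ι : Type*} {F : Filter ι}
    [F.NeBot] {x : ι → X} {o : X} {M : ℝ} (hM : ∀ᶠ i in F, dist o (x i) ≤ M)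
    (ξ : GromovBoundary hX) :
    ¬ Tendsto (fun i => (GromovBordification.point (x i) : GromovBordification hX)) F
      (𝓝 (.bdry ξ)) := by
  intro h
  -- The complement of a ball together with the whole Gromov boundary; it is open because `(z|η)_o'`
  -- is at most `dist o' z`.
  let S : Set (GromovBordification hX) := {p | ∀ z, p = .point z → M < dist o z}
  have hS : IsOpen S := by
    constructor
    · have : {z : X | (GromovBordification.point z : GromovBordification hX) ∈ S} =
          {z | M < dist o z} := by
        ext z
        simp [S]
      rw [this]
      exact isOpen_lt continuous_const (by fun_prop)
    · intro η _ o'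
      refine ⟨M + dist o' o, ?_⟩
      rintro y hy z rfl
      have := hy.trans_le (extGromovProduct_point_le o' η z)
      have : M + dist o' o < dist o' z := by exact_mod_cast this
      linarith [dist_triangle o' o z]
  have hξ : GromovBordification.bdry ξ ∈ S := by
    intro z hz
    cases hz
  obtain ⟨i, hi, hi'⟩ := ((h.eventually_mem (hS.mem_nhds hξ)).and hM).exists
  exact absurd (hi _ rfl) (not_lt.2 hi')

/-- If the mutual Gromov products of the points `x i` tend to infinity, then there is a boundary
point to which `y i` converges whenever `(x i|y i)` tends to infinity. -/
theorem exists_bdry_forall_tendsto (hX : IsGromovHyperbolic X) {ι : Type*} {F : Filter ι}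
    [F.NeBot] {x : ι → X} {o : X}
    (h : ∀ R : ℝ, ∃ A ∈ F, ∀ i ∈ A, ∀ j ∈ A, R ≤ gromovProduct o (x i) (x j)) :
    ∃ ξ : GromovBoundary hX, ∀ y : ι → X,
      (∀ R : ℝ, ∀ᶠ i in F, R ≤ gromovProduct o (y i) (x i)) →
      Tendsto (fun i => (GromovBordification.point (y i) : GromovBordification hX)) F
        (𝓝 (.bdry ξ)) := by
  obtain ⟨δ, hδ0, hδ⟩ := id hX
  choose A hAF hA using fun k : ℕ => h k
  -- Intersecting `A 0, ..., A k` puts `a m` in `A k` for all `k ≤ m`, which makes `x ∘ a` a Gromov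
  -- sequence; its class is the required `ξ`.
  have hne : ∀ k : ℕ, (⋂ j ∈ Finset.range (k + 1), A j).Nonempty := fun k =>
    F.nonempty_of_mem ((Filter.biInter_finset_mem _).2 fun j _ => hAF j)
  choose a ha using hne
  have haA : ∀ {k m : ℕ}, k ≤ m → a m ∈ A k := fun {k m} hkm =>
    mem_iInter₂.1 (ha m) k (Finset.mem_range.2 (by omega))
  have hs : IsGromovSequence (fun k => x (a k)) := by
    refine gromovEquivalent_of_basePoint o (tendsto_atTop_atTop.2 fun b => ?_)
    obtain ⟨k, hk⟩ := exists_nat_ge b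
    exact ⟨(k, k), fun p hp => hk.trans (hA k _ (haA hp.1) _ (haA hp.2))⟩
  refine ⟨Quotient.mk (gromovSetoid hX) ⟨_, hs⟩, fun y hy => ?_⟩
  rw [tendsto_nhds]
  intro S hS hξ
  obtain ⟨t, ht⟩ := hS.2 _ hξ o
  -- The chain `y i`, `x i`, `x (a m)`, `u n` has three consecutive products at least `k`; two uses
  -- of the four-point condition cost `2 * δ`.
  obtain ⟨k, hk⟩ := exists_nat_gt (t + 2 * δ)
  filter_upwards [hAF k, hy k] with i hiA hiy
  refine ht _ (lt_of_lt_of_le (b := ((k - 2 * δ : ℝ) : EReal)) ?_ (le_sInf ?_))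
  · exact_mod_cast (by linarith : t < k - 2 * δ)
  rintro _ ⟨u, ⟨hu, hus⟩, rfl⟩
  have hsu : GromovEquivalent u (fun k => x (a k)) := Quotient.exact hus
  obtain ⟨⟨N, N'⟩, hN⟩ := tendsto_atTop_atTop.1 (hsu o) k
  refine le_liminf_of_le (by isBoundedDefault) ?_
  filter_upwards [eventually_ge_atTop N] with n hn
  have e₁ := hN (n, max N' k) ⟨hn, le_max_left _ _⟩
  have e₂ := hA k i hiA _ (haA (le_max_right N' k))
  have e₃ := hδ (y i) (x i) (x (a (max N' k))) o
  have e₄ := hδ (y i) (x (a (max N' k))) (u n) o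
  rw [gromovProduct_comm] at e₁
  have e₅ := le_min hiy e₂
  have e₆ : (k : ℝ) - δ ≤ min (gromovProduct o (y i) (x (a (max N' k))))
      (gromovProduct o (x (a (max N' k))) (u n)) := le_min (by linarith) (by linarith)
  exact_mod_cast (by linarith : (k : ℝ) - 2 * δ ≤ gromovProduct o (y i) (u n))

/-- In a proper approximate length space the mutual Gromov products along an ultrafilter that
leaves every bounded set tend to infinity. -/
theorem HasApproxIntermediatePoints.exists_forall_le_gromovProduct [ProperSpace X]
    (h : HasApproxIntermediatePoints X) {ι : Type*} (F : Ultrafilter ι) {x : ι → X} {o : X}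
    (hx : Tendsto (fun i => dist o (x i)) F atTop) (R : ℝ) :
    ∃ A ∈ F, ∀ i ∈ A, ∀ j ∈ A, R ≤ gromovProduct o (x i) (x j) := by
  -- The margin 2 pays for the error 1 in the choice of `p i` and for its distance, less than 1,
  -- from the limit `q`.
  let R' := max 0 (R + 2)
  have hp : ∀ i, ∃ p ∈ Metric.closedBall o R', R' ≤ dist o (x i) →
      dist p (x i) ≤ dist o (x i) - R' + 1 := by
    intro i
    by_cases hi : R' ≤ dist o (x i)
    · obtain ⟨p, hp, hp'⟩ := h o (x i) R' (le_max_left _ _) hi 1 one_pos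
      exact ⟨p, by rwa [Metric.mem_closedBall, dist_comm], fun _ => hp'⟩
    · exact ⟨o, Metric.mem_closedBall_self (le_max_left _ _), fun hi' => absurd hi' hi⟩
  choose p hpR hpx using hp
  obtain ⟨q, -, hq⟩ := (isCompact_closedBall o R').ultrafilter_le_nhds (F.map p)
    (le_principal_iff.2 (Ultrafilter.mem_map.2 (univ_mem' hpR)))
  have hq' : ∀ᶠ i in (F : Filter ι), dist (p i) q < 1 := hq (Metric.ball_mem_nhds q one_pos)
  refine ⟨_, hq'.and (hx.eventually_ge_atTop R'), ?_⟩
  rintro i ⟨hi, hi'⟩ j ⟨hj, hj'⟩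
  have e₁ := hpx i hi'
  have e₂ := hpx j hj'
  have e₃ := dist_triangle q (p i) (x i)
  have e₄ := dist_triangle q (p j) (x j)
  have e₅ := dist_triangle_left (x i) (x j) q
  rw [dist_comm q (p _)] at e₃ e₄
  have e₆ : R + 2 ≤ R' := le_max_right _ _
  unfold gromovProduct
  linarith

/-- A point of a rough geodesic from `x` to `y` is within a bounded distance of `o` plus the Gromov
product `(x|y)_o`. -/
theorem exists_dist_le_gromovProduct_add {δ κ T : ℝ}
    (hδ : ∀ a b c o : X,
      min (gromovProduct o a b) (gromovProduct o b c) ≤ gromovProduct o a c + δ)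
    (hκ : 0 ≤ κ) (hT : 0 ≤ T) {σ : ℝ → X}
    (lower : ∀ s ∈ Icc 0 T, ∀ t ∈ Icc 0 T, |t - s| - κ ≤ dist (σ t) (σ s))
    (upper : ∀ s ∈ Icc 0 T, ∀ t ∈ Icc 0 T, dist (σ t) (σ s) ≤ |t - s| + κ) (o : X) :
    ∃ t ∈ Icc 0 T, dist o (σ t) ≤ gromovProduct o (σ 0) (σ T) + 2 * δ + 3 * κ := by
  have h0 : (0 : ℝ) ∈ Icc 0 T := left_mem_Icc.2 hT
  have h1 : T ∈ Icc 0 T := right_mem_Icc.2 hT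
  -- In the comparison tripod of `o`, `σ 0`, `σ T`, the centre is at distance `r` from `σ 0` and `(σ
  -- 0|σ T)_o` from `o`.
  set r := gromovProduct (σ 0) o (σ T) with hr
  have hr0 : 0 ≤ r := by
    rw [hr]
    unfold gromovProduct
    linarith [dist_triangle_left o (σ T) (σ 0)]
  have hrd : r ≤ dist (σ 0) (σ T) := by
    rw [hr, gromovProduct_comm]
    exact gromovProduct_le_dist _ _ _
  have hl := lower 0 h0 T h1
  have hu := upper 0 h0 T h1
  rw [sub_zero, abs_of_nonneg hT, dist_comm] at hl hu
  -- The length `r` may exceed `T`, but by at most `κ`.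
  have htT : min r T ∈ Icc 0 T := ⟨le_min hr0 hT, min_le_right _ _⟩
  refine ⟨min r T, htT, ?_⟩
  have e₁ := upper 0 h0 _ htT
  have e₂ := upper _ htT T h1
  rw [sub_zero, abs_of_nonneg htT.1] at e₁
  rw [abs_of_nonneg (sub_nonneg.2 htT.2)] at e₂
  have e₃ : r - κ ≤ min r T := le_min (by linarith) (by linarith)
  have e₄ : min r T ≤ r := min_le_left _ _
  -- Seen from this point of the curve, the endpoints have product at most `2 * κ`; hence `o` has a
  -- small product with one of them, and either case bounds the distance to `o`.
  have e₅ := hδ (σ 0) o (σ T) (σ (min r T))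
  rw [dist_comm] at e₂
  generalize σ (min r T) = p at *
  unfold gromovProduct at *
  rw [dist_comm (σ 0) o] at hr e₅
  rw [dist_comm o p]
  rcases min_le_iff.1 e₅ with e | e <;> linarith

end GromovConvergence

/-! ### Geodesics of the disc and chains of discs -/

section KobayashiLength

variable {d : ℕ}

/-- Positivity of the right-hand side for `a`, `c` in the disc is what makes Möbius maps preserve
the disc. -/
theorem norm_sq_sub_norm_sq_mobius (a c : ℂ) :
    ‖1 + (starRingEnd ℂ) a * c‖ ^ 2 - ‖c + a‖ ^ 2 = (1 - ‖a‖ ^ 2) * (1 - ‖c‖ ^ 2) := by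
  simp only [← Complex.normSq_eq_norm_sq, Complex.normSq_apply, Complex.add_re, Complex.add_im,
    Complex.mul_re, Complex.mul_im, Complex.conj_re, Complex.conj_im, Complex.one_re,
    Complex.one_im]
  ring

theorem one_add_conj_mul_ne_zero {a c : ℂ} (ha : ‖a‖ < 1) (hc : ‖c‖ < 1) :
    1 + (starRingEnd ℂ) a * c ≠ 0 := by
  intro h
  have h1 : ‖(starRingEnd ℂ) a * c‖ = 1 := by
    rw [eq_neg_of_add_eq_zero_right h, norm_neg, norm_one]
  rw [norm_mul, Complex.norm_conj] at h1
  nlinarith [norm_nonneg a, norm_nonneg c]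

theorem norm_mobius_lt_one {a c : ℂ} (ha : ‖a‖ < 1) (hc : ‖c‖ < 1) :
    ‖(c + a) / (1 + (starRingEnd ℂ) a * c)‖ < 1 := by
  rw [norm_div, div_lt_one (norm_pos_iff.2 (one_add_conj_mul_ne_zero ha hc))]
  refine lt_of_pow_lt_pow_left₀ 2 (norm_nonneg _) ?_
  have h1 : 0 < 1 - ‖a‖ ^ 2 := by nlinarith [norm_nonneg a]
  have h2 : 0 < 1 - ‖c‖ ^ 2 := by nlinarith [norm_nonneg c]
  have := norm_sq_sub_norm_sq_mobius a c
  nlinarith [mul_pos h1 h2]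

/-- Every disc can be reparametrized so that two given points have parameters `0` and
`ρ ∈ [0, 1)`. -/
theorem IsHolomorphicDisc.exists_normalized {Ω : Set (EuclideanSpace ℂ (Fin d))}
    {f : ℂ → EuclideanSpace ℂ (Fin d)} (hf : IsHolomorphicDisc Ω f) {a b : ℂ}
    (ha : a ∈ Metric.ball (0 : ℂ) 1) (hb : b ∈ Metric.ball (0 : ℂ) 1) :
    ∃ (g : ℂ → EuclideanSpace ℂ (Fin d)) (ρ : ℝ), IsHolomorphicDisc Ω g ∧ 0 ≤ ρ ∧ ρ < 1 ∧
      g 0 = f a ∧ g ρ = f b ∧ poincareDist a b = Real.artanh ρ := by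
  rw [mem_ball_zero_iff] at ha hb
  -- `β` is the image of `b` under the automorphism taking `a` to `0`. The rotation `u` below moves
  -- it to the positive radius, and `m` is the inverse of the composition.
  let β : ℂ := (b + -a) / (1 + (starRingEnd ℂ) (-a) * b)
  have hβ : ‖β‖ < 1 := norm_mobius_lt_one (by rwa [norm_neg]) hb
  have hne : 1 + (starRingEnd ℂ) (-a) * b ≠ 0 :=
    one_add_conj_mul_ne_zero (by rwa [norm_neg]) hb
  obtain ⟨u, hu, hβu⟩ : ∃ u : ℂ, ‖u‖ = 1 ∧ u * (‖β‖ : ℂ) = β := by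
    by_cases h0 : β = 0
    · exact ⟨1, norm_one, by simp [h0]⟩
    · have : (‖β‖ : ℂ) ≠ 0 := by exact_mod_cast norm_ne_zero_iff.2 h0
      refine ⟨β / ‖β‖, ?_, div_mul_cancel₀ _ this⟩
      rw [norm_div, Complex.norm_real, norm_norm, div_self (norm_ne_zero_iff.2 h0)]
  have hmaps : ∀ c ∈ Metric.ball (0 : ℂ) 1, ‖u * c‖ < 1 := fun c hc => by
    rw [norm_mul, hu, one_mul]
    exact mem_ball_zero_iff.1 hc
  let m : ℂ → ℂ := fun c => (u * c + a) / (1 + (starRingEnd ℂ) a * (u * c))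
  have hm : MapsTo m (Metric.ball 0 1) (Metric.ball 0 1) := fun c hc =>
    mem_ball_zero_iff.2 (norm_mobius_lt_one ha (hmaps c hc))
  have hmd : DifferentiableOn ℂ m (Metric.ball 0 1) := by
    refine DifferentiableOn.div (by fun_prop) (by fun_prop) fun c hc => ?_
    exact one_add_conj_mul_ne_zero ha (hmaps c hc)
  refine ⟨f ∘ m, ‖β‖, ⟨hf.1.comp hmd hm, hf.2.comp hm⟩, norm_nonneg _, hβ, ?_, ?_, ?_⟩
  · simp [m]
  · have : m ‖β‖ = b := by
      have h1 := one_add_conj_mul_ne_zero ha hβ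
      simp only [m, hβu]
      rw [div_eq_iff h1]
      have h2 : β * (1 + (starRingEnd ℂ) (-a) * b) = b + -a := div_mul_cancel₀ _ hne
      rw [map_neg] at h2
      linear_combination h2
    simp [this]
  · rw [poincareDist_comm]
    simp only [poincareDist, β, map_neg, neg_mul, sub_eq_add_neg]

theorem poincareDist_zero_ofReal {r : ℝ} (hr : 0 ≤ r) :
    poincareDist 0 r = Real.artanh r := by
  simp [poincareDist, abs_of_nonneg hr]

/-- The radius `[0, 1)` is a geodesic: distances along it add up. This permits cutting a disc at a
prescribed length. -/
theorem poincareDist_ofReal_ofReal {r ρ : ℝ} (hr : 0 ≤ r) (hrρ : r ≤ ρ) (hρ : ρ < 1) :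
    poincareDist r ρ = Real.artanh ρ - Real.artanh r := by
  have h1 : 0 < 1 - r * ρ := by nlinarith
  have hv : ‖((r : ℂ) - ρ) / (1 - (starRingEnd ℂ) (ρ : ℂ) * r)‖ = (ρ - r) / (1 - r * ρ) := by
    have : ((r : ℂ) - ρ) / (1 - (starRingEnd ℂ) (ρ : ℂ) * r) =
        (((r - ρ) / (1 - r * ρ) : ℝ) : ℂ) := by
      push_cast [Complex.conj_ofReal]
      rw [mul_comm (ρ : ℂ)]
    rw [this, Complex.norm_real, Real.norm_eq_abs, abs_div, abs_of_pos h1,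
      abs_of_nonpos (by linarith), neg_sub]
  have hv0 : 0 ≤ (ρ - r) / (1 - r * ρ) := div_nonneg (by linarith) h1.le
  have hv1 : (ρ - r) / (1 - r * ρ) < 1 := by
    rw [div_lt_one h1]
    nlinarith
  rw [poincareDist, hv, Real.artanh_eq_half_log ⟨by linarith, hv1.le⟩,
    Real.artanh_eq_half_log ⟨by linarith, hρ.le⟩, Real.artanh_eq_half_log ⟨by linarith, by linarith⟩,
    ← mul_sub, ← Real.log_div (div_ne_zero (by linarith) (by linarith))
      (div_ne_zero (by linarith) (by linarith))]
  congr 2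
  have h2 : 1 - r ≠ 0 := by linarith
  have h3 : 1 - ρ ≠ 0 := by linarith
  have h4 : 1 + r ≠ 0 := by linarith
  have h5 : 1 - r * ρ - (ρ - r) ≠ 0 := by nlinarith
  have h6 := h1.ne'
  rw [one_add_div h6, one_sub_div h6, div_div_div_cancel_right₀ h6, div_div_div_eq,
    div_eq_div_iff h5 (mul_ne_zero h3 h4)]
  ring

variable {Ω : Set (EuclideanSpace ℂ (Fin d))} {z w : EuclideanSpace ℂ (Fin d)}

theorem kobayashiDist_le_of_chain {L : ℝ} (h : KobayashiChain Ω z w L) :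
    kobayashiDist Ω z w ≤ L :=
  csInf_le ⟨0, fun _ h => KobayashiChain.nonneg h⟩ h

/-- A chain can be cut at every length. -/
theorem KobayashiChain.exists_cut {L : ℝ} (h : KobayashiChain Ω z w L) {s : ℝ} (hs : 0 ≤ s)
    (hsL : s ≤ L) : ∃ p, KobayashiChain Ω z p s ∧ KobayashiChain Ω p w (L - s) := by
  induction h generalizing s with
  | refl hz =>
    obtain rfl : s = 0 := le_antisymm hsL hs
    exact ⟨z, .refl z hz, by simpa using KobayashiChain.refl z hz⟩
  | @step L f hf a b ha hb h ih =>
    rcases le_total s L with hle | hle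
    · obtain ⟨p, hp, hp'⟩ := ih hs hle
      refine ⟨p, hp, ?_⟩
      rw [add_sub_right_comm]
      exact .step f hf a b ha hb hp'
    -- The cut falls in the last disc, at the parameter `r` with `artanh r = s - L`.
    · obtain ⟨g, ρ, hg, hρ0, hρ1, hga, hgb, hab⟩ := hf.exists_normalized ha hb
      rw [hab] at hsL ⊢
      rw [← hga] at h
      rw [← hgb]
      have hρI : ρ ∈ Ioo (-1 : ℝ) 1 := ⟨by linarith, hρ1⟩
      obtain ⟨r, hrI, hr⟩ := Real.artanh_surjOn (mem_univ (s - L))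
      have hr0 : 0 ≤ r := by
        by_contra hneg
        have := Real.artanh_neg ⟨hrI.1, not_le.1 hneg⟩
        linarith
      have hrρ : r ≤ ρ := (Real.artanh_le_artanh_iff hrI hρI).1 (by linarith)
      have hrball : (r : ℂ) ∈ Metric.ball (0 : ℂ) 1 := by
        simpa [abs_of_nonneg hr0] using hrI.2
      have hρball : (ρ : ℂ) ∈ Metric.ball (0 : ℂ) 1 := by
        simpa [abs_of_nonneg hρ0] using hρ1
      refine ⟨g r, ?_, ?_⟩
      · have := KobayashiChain.step g hg 0 r (by simp) hrball h
        rwa [poincareDist_zero_ofReal hr0, hr, add_sub_cancel] at this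
      · have := KobayashiChain.step g hg r ρ hrball hρball (.refl (g r) (hg.2 hrball))
        rw [poincareDist_ofReal_ofReal hr0 hrρ hρ1, hr] at this
        convert this using 1
        ring

/-- The points of a chain of length `L` starting at `z` sweep out a connected set of points whose
distance from `z` is at most `L`. -/
theorem KobayashiChain.exists_isPreconnected {L : ℝ} (h : KobayashiChain Ω z w L) :
    ∃ t ⊆ Ω, IsPreconnected t ∧ z ∈ t ∧ w ∈ t ∧ ∀ p ∈ t, kobayashiDist Ω z p ≤ L := by
  induction h with
  | refl hz =>
    refine ⟨{z}, by simpa, isPreconnected_singleton, rfl, rfl, ?_⟩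
    rintro p rfl
    exact kobayashiDist_le_of_chain (.refl _ hz)
  | @step L f hf a b ha hb h ih =>
    obtain ⟨t, htΩ, ht, hzt, hat, htL⟩ := ih
    obtain ⟨g, ρ, hg, hρ0, hρ1, hga, hgb, hab⟩ := hf.exists_normalized ha hb
    have hball : ∀ r ∈ Icc (0 : ℝ) ρ, (r : ℂ) ∈ Metric.ball (0 : ℂ) 1 := fun r hr => by
      simpa [abs_of_nonneg hr.1] using hr.2.trans_lt hρ1
    have hcont : ContinuousOn (fun r : ℝ => g r) (Icc 0 ρ) :=
      hg.1.continuousOn.comp Complex.continuous_ofReal.continuousOn hball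
    -- The arc of the new disc meets `t` at `f a`, and `artanh` is monotone along it.
    refine ⟨t ∪ (fun r : ℝ => g r) '' Icc 0 ρ, ?_, ?_, .inl hzt, .inr ⟨ρ, ⟨hρ0, le_rfl⟩, hgb⟩, ?_⟩
    · rintro p (hp | ⟨r, hr, rfl⟩)
      exacts [htΩ hp, hg.2 (hball r hr)]
    · exact ht.union (f a) hat ⟨0, ⟨le_rfl, hρ0⟩, by simpa using hga⟩
        (isPreconnected_Icc.image _ hcont)
    · rintro p (hp | ⟨r, hr, rfl⟩)
      · exact (htL p hp).trans (le_add_of_nonneg_right (poincareDist_nonneg a b))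
      · rw [← hga] at h
        refine (kobayashiDist_le_of_chain
          (.step g hg 0 r (by simp) (hball r hr) h)).trans ?_
        rw [poincareDist_zero_ofReal hr.1, hab]
        gcongr
        exact Real.artanh_le_artanh (by linarith [hr.1]) hρ1 hr.2

theorem KobayashiSpace.exists_chain_lt (Ω : ComplexDomain d) (x y : KobayashiSpace Ω) {r : ℝ}
    (hr : dist x y < r) : ∃ L < r, KobayashiChain Ω.carrier x.1 y.1 L := by
  obtain ⟨L, hL, hLr⟩ := exists_lt_of_csInf_lt (exists_kobayashiChain Ω x.2 y.2) hr
  exact ⟨L, hLr, hL⟩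

theorem KobayashiSpace.hasApproxIntermediatePoints (Ω : ComplexDomain d) :
    HasApproxIntermediatePoints (KobayashiSpace Ω) := by
  intro x y s hs hsd ε hε
  obtain ⟨L, hL, hchain⟩ := exists_chain_lt Ω x y (r := dist x y + ε) (by linarith)
  have hdL : dist x y ≤ L := kobayashiDist_le_of_chain hchain
  obtain ⟨p, hp, hp'⟩ := hchain.exists_cut hs (hsd.trans hdL)
  obtain ⟨t, htΩ, -, -, hpt, -⟩ := hp.exists_isPreconnected
  let q : KobayashiSpace Ω := ⟨p, htΩ hpt⟩
  have hq : dist q y ≤ L - s := kobayashiDist_le_of_chain hp'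
  exact ⟨q, kobayashiDist_le_of_chain hp, by linarith⟩

/-- Kobayashi balls are connected in the Euclidean topology. -/
theorem KobayashiSpace.isPreconnected_image_ball (Ω : ComplexDomain d) (x : KobayashiSpace Ω)
    (r : ℝ) : IsPreconnected ((fun y : KobayashiSpace Ω => y.1) '' Metric.ball x r) := by
  refine isPreconnected_of_forall x.1 ?_
  rintro _ ⟨y, hy, rfl⟩
  rw [Metric.mem_ball, dist_comm] at hy
  obtain ⟨L, hL, hchain⟩ := exists_chain_lt Ω x y hy
  obtain ⟨t, htΩ, ht, hxt, hyt, htL⟩ := hchain.exists_isPreconnected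
  refine ⟨t, fun p hp => ?_, hxt, hyt, ht⟩
  let q : KobayashiSpace Ω := ⟨p, htΩ hp⟩
  have hq : dist x q < r := (htL p hp).trans_lt hL
  exact ⟨q, by rwa [Metric.mem_ball, dist_comm], rfl⟩

end KobayashiLength

/-! ### Consequences of the extension of the identity -/

section Extension

/-- The boundary clause of the topology is vacuous for sets of interior points; the same holds for
ends. -/
theorem GromovBordification.isOpenEmbedding_point {X : Type*} [PseudoMetricSpace X]
    (hX : IsGromovHyperbolic X) :
    IsOpenEmbedding (GromovBordification.point : X → GromovBordification hX) := by
  refine .of_continuous_injective_isOpenMap (continuous_def.2 fun _ h => h.1)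
    (fun x y h => by injection h) fun S hS => ⟨?_, ?_⟩
  · convert hS using 1
    ext x
    simp
  · rintro ξ ⟨x, -, hx⟩
    cases hx

theorem EndCompactification.isOpenEmbedding_point (Y : Type*) [TopologicalSpace Y] :
    IsOpenEmbedding (EndCompactification.point : Y → EndCompactification Y) := by
  refine .of_continuous_injective_isOpenMap (continuous_def.2 fun _ h => h.1)
    (fun x y h => by injection h) fun S hS => ⟨?_, ?_⟩
  · convert hS using 1
    ext x
    simp
  · rintro ξ ⟨x, -, hx⟩
    cases hx

variable {d : ℕ} {Ω : ComplexDomain d} {hG : IsGromovHyperbolic (KobayashiSpace Ω)}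

/-- The inclusion of `Ω` in its Euclidean closure. -/
def KobayashiSpace.toClosure (z : KobayashiSpace Ω) : closure Ω.carrier :=
  ⟨z.1, subset_closure z.2⟩

/-- `Φ` intertwines the two open embeddings into the bordifications, and the second one factors
through the closure. -/
theorem IdExtendsToHomeomorph.isOpenEmbedding_toClosure (h : IdExtendsToHomeomorph Ω hG) :
    IsOpenEmbedding (KobayashiSpace.toClosure (Ω := Ω)) := by
  obtain ⟨Φ, hΦ⟩ := h
  refine IsOpenEmbedding.of_comp _ (EndCompactification.isOpenEmbedding_point _) ?_
  have : EndCompactification.point ∘ KobayashiSpace.toClosure =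
      Φ ∘ (GromovBordification.point : KobayashiSpace Ω → GromovBordification hG) :=
    funext fun z => (hΦ z).symm
  rw [this]
  exact Φ.isOpenEmbedding.comp (GromovBordification.isOpenEmbedding_point hG)

/-- The topology of the Kobayashi distance is the Euclidean one. -/
theorem IdExtendsToHomeomorph.isOpenEmbedding_val (h : IdExtendsToHomeomorph Ω hG) :
    IsOpenEmbedding (fun z : KobayashiSpace Ω => z.1) := by
  have he := h.isOpenEmbedding_toClosure
  have hcont : Continuous (fun z : KobayashiSpace Ω => z.1) :=
    (continuous_subtype_val (p := (· ∈ closure Ω.carrier))).comp he.continuous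
  refine .of_continuous_injective_isOpenMap hcont
    Subtype.val_injective fun S hS => ?_
  obtain ⟨U, hU, hUS⟩ := isOpen_induced_iff.1 (he.isOpenMap S hS)
  have : (fun z : KobayashiSpace Ω => z.1) '' S = U ∩ Ω.carrier := by
    ext z
    constructor
    · rintro ⟨y, hy, rfl⟩
      have hmem : y.toClosure ∈ Subtype.val ⁻¹' U := hUS ▸ mem_image_of_mem _ hy
      exact ⟨hmem, y.2⟩
    · rintro ⟨hzU, hz⟩
      have hmem : (⟨z, subset_closure hz⟩ : closure Ω.carrier) ∈ KobayashiSpace.toClosure '' S :=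
        hUS ▸ hzU
      obtain ⟨y, hy, hyz⟩ := hmem
      exact ⟨y, hy, congrArg Subtype.val hyz⟩
  rw [this]
  exact hU.inter Ω.isOpen

/-- A bounded family of points of `Ω` that converges in the end compactification converges in
`Ω`. -/
theorem IdExtendsToHomeomorph.exists_tendsto (h : IdExtendsToHomeomorph Ω hG) {ι : Type*}
    {F : Filter ι} [F.NeBot] {y : ι → KobayashiSpace Ω} {o : KobayashiSpace Ω} {M : ℝ}
    (hM : ∀ᶠ i in F, dist o (y i) ≤ M) {p : Ω.EndClosure}
    (hp : Tendsto (fun i => (EndCompactification.point (y i).toClosure : Ω.EndClosure)) F (𝓝 p)) :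
    ∃ z, Tendsto y F (𝓝 z) := by
  obtain ⟨Φ, hΦ⟩ := h
  have hq : Tendsto (fun i => (GromovBordification.point (y i) : GromovBordification hG)) F
      (𝓝 (Φ.symm p)) := by
    convert (Φ.symm.continuous.tendsto p).comp hp using 1
    funext i
    exact ((Φ.symm_apply_eq).2 (hΦ (y i)).symm).symm
  cases hc : Φ.symm p with
  | point z =>
    rw [hc] at hq
    exact ⟨z, ((GromovBordification.isOpenEmbedding_point hG).tendsto_nhds_iff).2 hq⟩
  | bdry ξ =>
    rw [hc] at hq
    exact absurd hq (not_tendsto_bdry_of_dist_le hM ξ)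

/-! ### Completeness -/

theorem KobayashiSpace.isPreconnected_toClosure_image_ball (x : KobayashiSpace Ω) (r : ℝ) :
    IsPreconnected (KobayashiSpace.toClosure '' Metric.ball x r) := by
  refine IsInducing.subtypeVal.isPreconnected_image.1 ?_
  rw [image_image]
  exact isPreconnected_image_ball Ω x r

/-- A Cauchy sequence without a limit has a tail contained in a ball that avoids a given compact
subset of the closure. -/
theorem IdExtendsToHomeomorph.exists_ball_disjoint (h : IdExtendsToHomeomorph Ω hG)
    {x : ℕ → KobayashiSpace Ω} (hx : CauchySeq x) (hlim : ¬ ∃ z, Tendsto x atTop (𝓝 z))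
    (C : TopologicalSpace.Compacts (closure Ω.carrier)) :
    ∃ (N : ℕ) (ε : ℝ), (∀ n ≥ N, x n ∈ Metric.ball (x N) ε) ∧
      KobayashiSpace.toClosure '' Metric.ball (x N) ε ⊆ (C : Set (closure Ω.carrier))ᶜ := by
  by_contra hne
  push Not at hne
  -- Otherwise points of `C` come arbitrarily close to the tails. They accumulate in `C`, hence
  -- converge in `Ω` along an ultrafilter, and the Cauchy sequence converges to the same limit.
  have key : ∀ k : ℕ, ∃ (N : ℕ) (y : KobayashiSpace Ω), k ≤ N ∧
      dist y (x N) < 1 / ((k : ℝ) + 1) ∧ y.toClosure ∈ C := by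
    intro k
    have hpos : (0 : ℝ) < 1 / ((k : ℝ) + 1) := Nat.one_div_pos_of_nat
    obtain ⟨N, hN⟩ := Metric.cauchySeq_iff.1 hx _ hpos
    have hnot := hne (max N k) (1 / ((k : ℝ) + 1)) fun n hn =>
      hN n ((le_max_left N k).trans hn) _ (le_max_left N k)
    obtain ⟨_, ⟨y, hy, rfl⟩, hyC⟩ := not_subset.1 hnot
    exact ⟨max N k, y, le_max_right _ _, hy, not_not.1 hyC⟩
  choose N y hN hy hyC using key
  let U : Ultrafilter ℕ := hyperfilter ℕ
  have hU : (U : Filter ℕ) ≤ atTop := Nat.hyperfilter_le_atTop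
  obtain ⟨c, -, hc⟩ := C.isCompact.ultrafilter_le_nhds (U.map fun k => (y k).toClosure)
    (le_principal_iff.2 (Ultrafilter.mem_map.2 (univ_mem' hyC)))
  have hc' : Tendsto (fun k => (y k).toClosure) U (𝓝 c) := hc
  obtain ⟨R, -, hR⟩ := cauchySeq_bdd hx
  have hM : ∀ k, dist (x 0) (y k) ≤ R + 1 := fun k => by
    have h1 : 1 / ((k : ℝ) + 1) ≤ 1 := by
      rw [div_le_one (by positivity)]
      linarith [(Nat.cast_nonneg k : (0 : ℝ) ≤ k)]
    linarith [dist_triangle_right (x 0) (y k) (x (N k)), hR 0 (N k), hy k]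
  obtain ⟨z, hz⟩ := h.exists_tendsto (F := (U : Filter ℕ)) (Eventually.of_forall hM)
    (((EndCompactification.isOpenEmbedding_point _).continuous.tendsto c).comp hc')
  have hxz : Tendsto (x ∘ N) U (𝓝 z) := by
    refine hz.congr_dist (squeeze_zero (fun _ => dist_nonneg) (fun k => (hy k).le) ?_)
    exact tendsto_one_div_add_atTop_nhds_zero_nat.mono_left hU
  have hNtop : Tendsto N U atTop := (tendsto_atTop_mono hN tendsto_id).mono_left hU
  exact hlim ⟨z, le_nhds_of_cauchy_adhp hx (ClusterPt.of_le_nhds' (f := map (x ∘ N) U) hxz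
    inferInstance |>.mono (map_mono hNtop))⟩

theorem IdExtendsToHomeomorph.completeSpace (h : IdExtendsToHomeomorph Ω hG) :
    CompleteSpace (KobayashiSpace Ω) := by
  refine Metric.complete_of_cauchySeq_tendsto fun x hx => ?_
  by_contra hlim
  choose N ε htail hdisj using h.exists_ball_disjoint hx hlim
  have hmem : ∀ C, ∀ n ≥ N C, (x n).toClosure ∈
      connectedComponentIn (C : Set (closure Ω.carrier))ᶜ (x (N C)).toClosure := fun C n hn =>
    (KobayashiSpace.isPreconnected_toClosure_image_ball (x (N C)) (ε C)).subset_connectedComponentIn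
      (mem_image_of_mem _ (htail C _ le_rfl)) (hdisj C) (mem_image_of_mem _ (htail C n hn))
  let e : SpaceEnd (closure Ω.carrier) :=
    { comp := fun C => connectedComponentIn (C : Set (closure Ω.carrier))ᶜ (x (N C)).toClosure
      isComponent := fun C => ⟨_, hdisj C (mem_image_of_mem _ (htail C _ le_rfl)), rfl⟩
      -- At the index `max (N K) (N L)` the sequence lies in both components, so both can be based
      -- at that point.
      anti := fun K L hKL => by
        rw [connectedComponentIn_eq (hmem K _ (le_max_left (N K) (N L))),
          connectedComponentIn_eq (hmem L _ (le_max_right (N K) (N L)))]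
        exact connectedComponentIn_mono _ (compl_subset_compl.2 hKL) }
  have he : Tendsto (fun n => (EndCompactification.point (x n).toClosure : Ω.EndClosure)) atTop
      (𝓝 (.atEnd e)) := by
    rw [tendsto_nhds]
    intro W hW heW
    obtain ⟨C, hC⟩ := hW.2 e heW
    filter_upwards [eventually_ge_atTop (N C)] with n hn
    exact hC (.inl ⟨_, hmem C n hn, rfl⟩)
  obtain ⟨R, -, hR⟩ := cauchySeq_bdd hx
  exact hlim (h.exists_tendsto (Eventually.of_forall fun n => (hR 0 n).le) he)

/-! ### Properness and visibility -/

theorem IdExtendsToHomeomorph.properSpace (h : IdExtendsToHomeomorph Ω hG) :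
    ProperSpace (KobayashiSpace Ω) := by
  have := h.completeSpace
  have := h.isOpenEmbedding_val.locallyCompactSpace
  exact (KobayashiSpace.hasApproxIntermediatePoints Ω).properSpace

theorem IdExtendsToHomeomorph.visibilityCondition (h : IdExtendsToHomeomorph Ω hG) :
    VisibilityCondition Ω 1 := by
  intro κ hκ _ _ _ _ _ V W _ _ _ _ hVW
  by_contra hne
  push Not at hne
  have := h.properSpace
  obtain ⟨o₀, ho₀⟩ := Ω.isConnected.nonempty
  let o : KobayashiSpace Ω := ⟨o₀, ho₀⟩
  obtain ⟨δ, -, hδ⟩ := id hG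
  have key : ∀ n : ℕ, ∃ x y : KobayashiSpace Ω,
      (EndCompactification.point x.toClosure : Ω.EndClosure) ∈ V ∧
      (EndCompactification.point y.toClosure : Ω.EndClosure) ∈ W ∧
      (n : ℝ) < dist o x ∧ (n : ℝ) ≤ gromovProduct o x y + 2 * δ + 3 * κ := by
    intro n
    -- The compact set offered to the negated condition is the closed Kobayashi ball of radius `n`.
    obtain ⟨T, σ, hσ, hV, hW, hdisj⟩ := hne _
      ((isCompact_closedBall o (n : ℝ)).image h.isOpenEmbedding_val.continuous)
      (by rintro _ ⟨y, -, rfl⟩; exact y.2)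
    -- Projecting the time to `[0, T]` makes `σ` a total map into `Ω`.
    let τ : ℝ → KobayashiSpace Ω := fun t => ⟨σ (projIcc 0 T hσ.nonneg t),
      hσ.mapsTo (projIcc 0 T hσ.nonneg t).2⟩
    have hτ : ∀ t ∈ Icc 0 T, (τ t).1 = σ t := fun t ht => by
      simp only [τ, projIcc_of_mem hσ.nonneg ht]
    have hfar : ∀ t ∈ Icc 0 T, (n : ℝ) < dist o (τ t) := fun t ht => by
      by_contra hle
      refine (eq_empty_iff_forall_notMem.1 hdisj) (σ t) ⟨mem_image_of_mem _ ht, τ t, ?_, hτ t ht⟩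
      rw [Metric.mem_closedBall, dist_comm]
      exact not_lt.1 hle
    have h0 : (0 : ℝ) ∈ Icc 0 T := left_mem_Icc.2 hσ.nonneg
    have h1 : T ∈ Icc 0 T := right_mem_Icc.2 hσ.nonneg
    obtain ⟨t, ht, hdist⟩ := exists_dist_le_gromovProduct_add hδ hκ hσ.nonneg (σ := τ)
      (fun s hs t ht => by
        have := hσ.lower s hs t ht
        rwa [inv_one, one_mul, ← hτ s hs, ← hτ t ht] at this)
      (fun s hs t ht => by
        have := hσ.upper s hs t ht
        rwa [one_mul, ← hτ s hs, ← hτ t ht] at this) o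
    refine ⟨τ 0, τ T, ?_, ?_, hfar 0 h0, ((hfar t ht).trans_le hdist).le⟩
    · convert hV using 1
      exact congrArg EndCompactification.point (Subtype.ext (hτ 0 h0))
    · convert hW using 1
      exact congrArg EndCompactification.point (Subtype.ext (hτ T h1))
  choose x y hxV hyW hxfar hxy using key
  let U : Ultrafilter ℕ := hyperfilter ℕ
  have hU : (U : Filter ℕ) ≤ atTop := Nat.hyperfilter_le_atTop
  have hxtop : Tendsto (fun n => dist o (x n)) U atTop :=
    (tendsto_atTop_mono (fun n => (hxfar n).le) tendsto_natCast_atTop_atTop).mono_left hU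
  have hxx := (KobayashiSpace.hasApproxIntermediatePoints Ω).exists_forall_le_gromovProduct U hxtop
  obtain ⟨ξ, hξ⟩ := exists_bdry_forall_tendsto hG hxx
  have hx := hξ x fun R => by
    obtain ⟨A, hA, hAR⟩ := hxx R
    filter_upwards [hA] with i hi using hAR i hi i hi
  -- The same `ξ` serves for `y`, since `(x n|y n)_o ≥ n - 2 * δ - 3 * κ`.
  have hy := hξ y fun R => by
    obtain ⟨k, hk⟩ := exists_nat_ge (R + 2 * δ + 3 * κ)
    filter_upwards [hU (eventually_ge_atTop k)] with n hn
    have hkn : (k : ℝ) ≤ n := by exact_mod_cast hn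
    rw [gromovProduct_comm]
    linarith [hxy n]
  obtain ⟨Φ, hΦ⟩ := h
  have hlim : ∀ (u : ℕ → KobayashiSpace Ω) (S : Set Ω.EndClosure),
      (∀ n, (EndCompactification.point (u n).toClosure : Ω.EndClosure) ∈ S) →
      Tendsto (fun n => (GromovBordification.point (u n) : GromovBordification hG)) U
        (𝓝 (.bdry ξ)) → Φ (.bdry ξ) ∈ closure S := fun u S huS hu =>
    mem_closure_of_tendsto ((Φ.continuous.tendsto _).comp hu) (Eventually.of_forall fun n => by
      rw [Function.comp_apply, hΦ]
      exact huS n)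
  exact disjoint_left.1 hVW (hlim x V hxV hx) (hlim y W hyW hy)

end Extension

theorem theorem1p5 {d : ℕ} (Ω : ComplexDomain d) (hK : IsKobayashiHyperbolic Ω)
    (hG : IsGromovHyperbolic (KobayashiSpace Ω)) (hid : IdExtendsToHomeomorph Ω hG) :
    CompleteSpace (KobayashiSpace Ω) ∧ IsWeakVisibilityDomain Ω := by
  exact ⟨hid.completeSpace, hK, hid.visibilityCondition⟩
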